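/- A boolean circuit on $n$ input bits is a directed acyclic graph of AND, OR and NOT gates, where AND and OR gates have unbounded fan-in and every gate has unbounded fan-out, with a designated output. Its depth is the maximum number of AND and OR gates on a directed path from an input or a gate to the output, and its size is the number of its AND and OR gates (NOT gates are counted neither in the depth nor in the size). The $n$-bit parity function maps $x\in\{0,1\}^n$ to $x_1+\dots+x_n \bmod 2$. Theorem. There is a function $\delta:\mathbb N\to\mathbb R$ with $\delta(n)\to 0$ as $n\to\infty$ such that, for all sufficiently large $n$, every boolean circuit of depth at most $4$ that computes the $n$-bit parity function has size at least $2^{n^{1/3-\delta(n)}}$. In particular, it has at least that many gates. -/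

import Mathlib

open Filter Topology

namespace ParityCircuit

/-- A gate that reads its inputs from the `n` input variables and from `i` earlier gates:
an unbounded fan-in conjunction or disjunction (the empty ones are the constants true and
false), or a negation. -/
inductive Gate (n i : ℕ) : Type
  | conj (S : Finset (Fin n ⊕ Fin i)) : Gate n i
  | disj (S : Finset (Fin n ⊕ Fin i)) : Gate n i
  | neg (c : Fin n ⊕ Fin i) : Gate n i

/-- The contribution of a gate to the size of a circuit:
conjunctions and disjunctions count, negations are free. -/
def Gate.weight {n i : ℕ} : Gate n i → ℕ
  | .conj _ => 1
  | .disj _ => 1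
  | .neg _ => 0

/-- A boolean circuit on `n` input variables: a directed acyclic graph of gates (arbitrary
fan-out), listed in a topological order, with a designated output, which is an input variable
or a gate. -/
structure Circuit (n : ℕ) : Type where
  numGates : ℕ
  gate : (i : Fin numGates) → Gate n i
  output : Fin n ⊕ Fin numGates

namespace Circuit

variable {n : ℕ}

/-- The value of the `i`-th gate on the input `x`. -/
def gateVal (C : Circuit n) (x : Fin n → Bool) (i : ℕ) (hi : i < C.numGates) : Bool :=
  match C.gate ⟨i, hi⟩ with
  | .conj S => decide (∀ c ∈ S,
      Sum.elim x (fun j : Fin i => C.gateVal x j.val (j.isLt.trans hi)) c = true)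
  | .disj S => decide (∃ c ∈ S,
      Sum.elim x (fun j : Fin i => C.gateVal x j.val (j.isLt.trans hi)) c = true)
  | .neg c => !(Sum.elim x (fun j : Fin i => C.gateVal x j.val (j.isLt.trans hi)) c)
termination_by i
decreasing_by all_goals exact j.isLt

/-- The value of the circuit on the input `x`. -/
def eval (C : Circuit n) (x : Fin n → Bool) : Bool :=
  Sum.elim x (fun j : Fin C.numGates => C.gateVal x j.val j.isLt) C.output

/-- The depth of the `i`-th gate: the largest number of conjunctions and disjunctions on a path
that ends in this gate (the gate itself included). Input variables have depth zero. -/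
def gateDepth (C : Circuit n) (i : ℕ) (hi : i < C.numGates) : ℕ :=
  match C.gate ⟨i, hi⟩ with
  | .conj S => S.sup
      (Sum.elim (fun _ => 0) (fun j : Fin i => C.gateDepth j.val (j.isLt.trans hi))) + 1
  | .disj S => S.sup
      (Sum.elim (fun _ => 0) (fun j : Fin i => C.gateDepth j.val (j.isLt.trans hi))) + 1
  | .neg c => Sum.elim (fun _ => 0) (fun j : Fin i => C.gateDepth j.val (j.isLt.trans hi)) c
termination_by i
decreasing_by all_goals exact j.isLt

/-- The depth of the circuit: the largest number of conjunctions and disjunctions on a path that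
ends in the output. -/
def depth (C : Circuit n) : ℕ :=
  Sum.elim (fun _ => 0) (fun j : Fin C.numGates => C.gateDepth j.val j.isLt) C.output

/-- The number of conjunction and disjunction gates of the circuit. -/
def size (C : Circuit n) : ℕ := ∑ i : Fin C.numGates, (C.gate i).weight

end Circuit

/-- The `n`-bit parity function: true iff an odd number of the bits are true. -/
def parity {n : ℕ} (x : Fin n → Bool) : Bool :=
  decide (Odd (Finset.univ.filter fun i : Fin n => x i = true).card)

end ParityCircuit

/-! This is Håstad's random restriction argument. The key is the switching lemma: if a function or
its negation has certificates of size `k`, a random restriction leaving each variable free with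
probability `1 / (16 * k + 1)` leaves it without a decision tree of depth `s` with probability at
most `2 ^ -(s + 1)` (`sum_weight_not_decTree_le`). It is proved by encoding (`exists_decoder`): a
bad restriction is mapped to an extension with more fixed variables, hence much larger weight, and
few bad restrictions share an extension.

If all gates of depth at most `d` have decision trees of depth `k`, then each gate of depth at most
`d + 1`, or its negation, has certificates of size `k`. A union bound and an expected value give one
restriction under which these gates have trees of depth `s`, while at least a fraction `1 / (68 *
k)` of the variables stays free. The first round starts from literals, so `k = 1` and it costs only
a constant factor; the next two have `k = s`. The output of a depth 4 circuit, or its negation, then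
has certificates of size `s`, but parity needs every free variable in a certificate. Hence `n ≤ (68
* s) ^ 3` whenever `17 * s * C.size ≤ 2 ^ s`, and `s` about `n ^ (1 / 3) / 69` gives the bound. -/

namespace ParityCircuit

/-! ### Restrictions, decision trees and certificates -/

variable {n : ℕ}

/-- A restriction fixes some of the variables; `none` marks a variable that stays free. -/
abbrev Restriction (n : ℕ) := Fin n → Option Bool

namespace Restriction

/-- The input that agrees with `ρ` on the fixed variables and with `x` on the free ones. -/
def fill (ρ : Restriction n) (x : Fin n → Bool) : Fin n → Bool := fun v => (ρ v).getD (x v)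

/-- The free variables of a restriction. -/
def stars (ρ : Restriction n) : Finset (Fin n) := Finset.univ.filter fun v => ρ v = none

/-- `ρ'` extends `ρ`. -/
def Le (ρ ρ' : Restriction n) : Prop := ∀ v b, ρ v = some b → ρ' v = some b

/-- No variable is fixed to different values. -/
def Compat (ρ ρ' : Restriction n) : Prop := ∀ v b c, ρ v = some b → ρ' v = some c → b = c

/-- Overwrite the variables in `Y` by the indicator of `A`. -/
def setOn (Y A : Finset (Fin n)) (ρ : Restriction n) : Restriction n :=
  fun v => if v ∈ Y then some (decide (v ∈ A)) else ρ v

/-- Free the variables in `Y`. -/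
def unset (Y : Finset (Fin n)) (ρ : Restriction n) : Restriction n :=
  fun v => if v ∈ Y then none else ρ v

/-- Apply `ρ`, then `ρ'` to the variables that are left. -/
def comp (ρ ρ' : Restriction n) : Restriction n := fun v => (ρ v).or (ρ' v)

@[simp] theorem mem_stars {ρ : Restriction n} {v : Fin n} : v ∈ ρ.stars ↔ ρ v = none := by
  simp [stars]

theorem fill_comp (ρ ρ' : Restriction n) (x : Fin n → Bool) :
    (ρ.comp ρ').fill x = ρ.fill (ρ'.fill x) := by
  funext v
  simp only [fill, comp]
  cases ρ v <;> simp

theorem stars_comp (ρ ρ' : Restriction n) : (ρ.comp ρ').stars = ρ.stars ∩ ρ'.stars := by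
  ext v
  simp [comp, Option.or_eq_none_iff]

theorem fill_update_of_none {ρ : Restriction n} {v : Fin n} (h : ρ v = none)
    (x : Fin n → Bool) (b : Bool) :
    ρ.fill (Function.update x v b) = Function.update (ρ.fill x) v b := by
  funext u
  by_cases hu : u = v
  · subst hu; simp [fill, h]
  · simp [fill, hu]

theorem fill_update_of_some {ρ : Restriction n} {v : Fin n} {c : Bool} (h : ρ v = some c)
    (x : Fin n → Bool) (b : Bool) :
    ρ.fill (Function.update x v b) = Function.update (ρ.fill x) v c := by
  funext u
  by_cases hu : u = v
  · subst hu; simp [fill, h]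
  · simp [fill, hu]

end Restriction

open Restriction

/-- `f` is computed by a decision tree of depth at most `t`. -/
inductive DecTree : ℕ → ((Fin n → Bool) → Bool) → Prop
  | const (t : ℕ) (f : (Fin n → Bool) → Bool) (b : Bool) (h : ∀ x, f x = b) : DecTree t f
  | query (t : ℕ) (f : (Fin n → Bool) → Bool) (v : Fin n)
      (h : ∀ b, DecTree t (fun x => f (Function.update x v b))) : DecTree (t + 1) f

/-- Every input that `f` accepts has a certificate of at most `k` variables. -/
def HasCert (k : ℕ) (f : (Fin n → Bool) → Bool) : Prop :=
  ∀ x, f x = true → ∃ Y : Finset (Fin n), Y.card ≤ k ∧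
    ∀ y, (∀ v ∈ Y, y v = x v) → f y = true

namespace DecTree

theorem mono {t t' : ℕ} {f : (Fin n → Bool) → Bool} (h : DecTree t f) (ht : t ≤ t') :
    DecTree t' f := by
  induction h generalizing t' with
  | const t f b h => exact .const _ _ b h
  | query t f v h ih =>
    obtain ⟨u, rfl⟩ : ∃ u, t' = u + 1 := ⟨t' - 1, by omega⟩
    exact .query _ _ v fun b => ih b (by omega)

theorem not {t : ℕ} {f : (Fin n → Bool) → Bool} (h : DecTree t f) :
    DecTree t (fun x => !f x) := by
  induction h with
  | const t f b h => exact .const _ _ (!b) fun x => by rw [h]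
  | query t f v h ih => exact .query _ _ v ih

/-- The variables queried on the path followed by `x` form the certificate. -/
theorem hasCert {t : ℕ} {f : (Fin n → Bool) → Bool} (h : DecTree t f) : HasCert t f := by
  induction h with
  | const t f b h => exact fun x hx => ⟨∅, by simp, fun y _ => by rw [h, ← h x, hx]⟩
  | query t f v h ih =>
    intro x hx
    obtain ⟨Y, hY, hc⟩ := ih (x v) x (by simpa using hx)
    refine ⟨insert v Y, (Finset.card_insert_le _ _).trans (by omega), fun y hy => ?_⟩
    have := hc y fun u hu => hy u (Finset.mem_insert_of_mem hu)
    rw [← hy v (Finset.mem_insert_self _ _)] at this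
    simpa only [Function.update_eq_self] using this

theorem fill {t : ℕ} {f : (Fin n → Bool) → Bool} (h : DecTree t f) (ρ : Restriction n) :
    DecTree t (fun x => f (ρ.fill x)) := by
  induction h with
  | const t f b h => exact .const _ _ b fun x => h _
  | query t f v h ih =>
    refine .query _ _ v fun b => ?_
    cases hv : ρ v with
    | none => simpa only [fill_update_of_none hv] using ih b
    | some c => simpa only [fill_update_of_some hv] using ih c

theorem literal (v : Fin n) {t : ℕ} (ht : 1 ≤ t) : DecTree t (fun x : Fin n → Bool => x v) :=
  (DecTree.query 0 _ v fun b => .const _ _ b fun x => by simp).mono ht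

/-- Query all the variables in `Y`. -/
theorem of_setOn {t : ℕ} {f : (Fin n → Bool) → Bool} (Y : Finset (Fin n)) :
    ∀ ρ : Restriction n, Y ⊆ ρ.stars →
      (∀ A, DecTree t (fun x => f ((setOn Y A ρ).fill x))) →
      DecTree (t + Y.card) (fun x => f (ρ.fill x)) := by
  induction Y using Finset.induction with
  | empty =>
    intro ρ _ h
    have e : setOn ∅ ∅ ρ = ρ := by funext v; simp [setOn]
    simpa [e] using h ∅
  | insert v Y hv ih =>
    intro ρ hρ h
    rw [Finset.card_insert_of_notMem hv, ← add_assoc]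
    have hvn : ρ v = none := mem_stars.1 (hρ (Finset.mem_insert_self _ _))
    refine .query _ _ v fun b => ?_
    have e : ∀ x, ρ.fill (Function.update x v b)
        = Restriction.fill (Function.update ρ v (some b)) x := by
      intro x
      funext u
      by_cases hu : u = v
      · subst hu; simp [Restriction.fill, hvn]
      · simp [Restriction.fill, hu]
    simp only [e]
    refine ih _ (fun u hu => ?_) fun A => ?_
    · have huv : u ≠ v := fun e => hv (e ▸ hu)
      have := mem_stars.1 (hρ (Finset.mem_insert_of_mem hu))
      simpa [huv] using this
    -- The answer `b` at `v` is absorbed into the set `A` that records the answers.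
    · have e2 : setOn Y A (Function.update ρ v (some b))
          = setOn (insert v Y) (if b then insert v A else A.erase v) ρ := by
        funext u
        by_cases hu : u = v
        · subst hu; cases b <;> simp [setOn, hv]
        · cases b <;> simp [setOn, hu]
      rw [e2]
      exact h _

end DecTree

end ParityCircuit

/-! ### Encoding of bad restrictions -/

namespace ParityCircuit

open Restriction

variable {n : ℕ}

/-- The restriction `ρ` leaves a function whose decision tree depth is at least `s`. -/
def IsBad (f : (Fin n → Bool) → Bool) (s : ℕ) (ρ : Restriction n) : Prop :=
  ∀ t, DecTree t (fun x => f (ρ.fill x)) → s ≤ t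

/-- The fixed variables of a restriction. -/
def Restriction.fixed (ρ : Restriction n) : Finset (Fin n) :=
  Finset.univ.filter fun v => ρ v ≠ none

@[simp] theorem Restriction.mem_fixed {ρ : Restriction n} {v : Fin n} :
    v ∈ ρ.fixed ↔ ρ v ≠ none := by
  simp [fixed]

theorem Restriction.card_stars_add_card_fixed (ρ : Restriction n) :
    ρ.stars.card + ρ.fixed.card = n := by
  simpa [stars, fixed] using
    Finset.card_filter_add_card_filter_not (s := (Finset.univ : Finset (Fin n)))
      (fun v => ρ v = none)

/-- Extending a restriction can only falsify more terms, so the first term not falsified stays first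
as long as it survives. This lets the decoder find it from the extension. -/
theorem find?_eq_some_of_imp {α : Type*} {p q : α → Bool} {l : List α} {a : α}
    (h : l.find? p = some a) (hqp : ∀ x, q x = true → p x = true) (ha : q a = true) :
    l.find? q = some a := by
  induction l with
  | nil => simp at h
  | cons x l ih =>
    by_cases hx : q x = true
    · have : p x = true := hqp x hx
      simp only [List.find?_cons, this, hx] at h ⊢
      exact h
    · simp only [List.find?_cons, hx] at h ⊢
      cases hp : p x with
      | true =>
        simp only [hp, Option.some.injEq] at h
        exact absurd (h ▸ ha) hx
      | false => exact ih (by simpa [hp] using h)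

open Classical in
/-- A function with certificates of size `k` is a disjunction of terms of width `k`. -/
theorem HasCert.exists_terms {k : ℕ} {f : (Fin n → Bool) → Bool} (h : HasCert k f) :
    ∃ F : List (Restriction n), (∀ T ∈ F, T.fixed.card ≤ k) ∧
      (∀ T ∈ F, ∀ x, (∀ v b, T v = some b → x v = b) → f x = true) ∧
      ∀ x, f x = true → ∃ T ∈ F, ∀ v b, T v = some b → x v = b := by
  refine ⟨(Finset.univ.filter fun T : Restriction n => T.fixed.card ≤ k ∧
    ∀ x, (∀ v b, T v = some b → x v = b) → f x = true).toList, ?_, ?_, ?_⟩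
  · intro T hT
    simp only [Finset.mem_toList, Finset.mem_filter] at hT
    exact hT.2.1
  · intro T hT
    simp only [Finset.mem_toList, Finset.mem_filter] at hT
    exact hT.2.2
  · intro x hx
    obtain ⟨Y, hY, hc⟩ := h x hx
    refine ⟨fun v => if v ∈ Y then some (x v) else none, ?_, ?_⟩
    · simp only [Finset.mem_toList, Finset.mem_filter, Finset.mem_univ, true_and]
      refine ⟨?_, fun y hy => hc y fun v hv => hy v (x v) (by simp [hv])⟩
      convert hY
      ext v
      simp
    · intro v b hb
      by_cases hv : v ∈ Y
      · simpa [hv] using hb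
      · simp [hv] at hb

/-- A bad restriction stays bad after querying the free variables of the first term that it does
not falsify (or some of them, when there are too many). -/
theorem exists_query_of_isBad {f : (Fin n → Bool) → Bool} {s : ℕ} (hs : 0 < s)
    {ρ : Restriction n} (hρ : IsBad f s ρ) {Y : Finset (Fin n)} (hY : Y ⊆ ρ.stars)
    (hne : Y.Nonempty) :
    ∃ Y' ⊆ Y, Y'.Nonempty ∧ Y'.card ≤ s ∧ (Y' = Y ∨ Y'.card = s) ∧
      ∃ A, IsBad f (s - Y'.card) (setOn Y' A ρ) := by
  by_cases hc : s ≤ Y.card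
  · obtain ⟨Y', hY', hcard⟩ := Finset.exists_subset_card_eq hc
    -- The remaining threshold is `0`, for which every restriction is bad, so any answers will do.
    refine ⟨Y', hY', Finset.card_pos.1 (by omega), hcard.le, Or.inr hcard, ∅, fun t _ => by omega⟩
  · refine ⟨Y, subset_rfl, hne, by omega, Or.inl rfl, ?_⟩
    -- If every answer left a tree of depth below `s - Y.card`, querying `Y` first would give a tree
    -- of depth `s - 1`.
    by_contra! hA
    have := DecTree.of_setOn (f := f) (t := s - Y.card - 1) Y ρ hY fun A => by
      have := hA A
      simp only [IsBad, not_forall] at this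
      obtain ⟨t, ht, hlt⟩ := this
      exact ht.mono (by omega)
    have := hρ _ this
    omega

/-- This counts the decoder's guesses: a set `Y`, one of `2 ^ Y.card` answers, then the recursive
choices. After division by `(4 * k) ^ s` the sum is at most `(1 + 1 / (2 * k)) ^ k - 1 ≤ √e - 1 ≤
1`. -/
theorem sum_powerset_nonempty_le {U : Finset (Fin n)} {k : ℕ} (hU : U.card ≤ k) (hk : 1 ≤ k)
    (s : ℕ) :
    ∑ Y ∈ U.powerset with Y.Nonempty ∧ Y.card ≤ s,
      (2 : ℝ) ^ Y.card * (4 * k) ^ (s - Y.card) ≤ (4 * k) ^ s := by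
  have hk0 : (0 : ℝ) < k := by exact_mod_cast hk
  have h1 : ∀ Y ∈ U.powerset.filter (fun Y => Y.Nonempty ∧ Y.card ≤ s),
      (2 : ℝ) ^ Y.card * (4 * k) ^ (s - Y.card) = (4 * k) ^ s * (1 / (2 * k)) ^ Y.card := by
    intro Y hY
    obtain ⟨-, -, hYs⟩ := Finset.mem_filter.1 hY
    obtain ⟨t, rfl⟩ := Nat.exists_eq_add_of_le hYs
    rw [Nat.add_sub_cancel_left, pow_add, mul_right_comm, ← mul_pow]
    congr 2
    field_simp
    norm_num
  rw [Finset.sum_congr rfl h1, ← Finset.mul_sum]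
  refine mul_le_of_le_one_right (by positivity) ?_
  have h2 : ∑ Y ∈ U.powerset, (1 / (2 * k) : ℝ) ^ Y.card = (1 / (2 * k) + 1) ^ U.card := by
    rw [← Finset.sum_pow_mul_eq_add_pow]
    simp
  have h3 : (1 / (2 * k) + 1 : ℝ) ^ U.card ≤ 2 := by
    calc (1 / (2 * k) + 1 : ℝ) ^ U.card ≤ (1 / (2 * k) + 1) ^ k :=
          pow_le_pow_right₀ (by simp) hU
      _ ≤ Real.exp (1 / (2 * k)) ^ k := by
          gcongr
          exact Real.add_one_le_exp _
      _ = Real.exp (1 / 2) := by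
          rw [← Real.exp_nat_mul]
          congr 1
          field_simp
      _ ≤ 2 := by
          have h := Real.exp_one_lt_d9
          have e : Real.exp (1 / 2) ^ 2 = Real.exp 1 := by
            rw [← Real.exp_nat_mul]; norm_num
          nlinarith [Real.exp_pos (1 / 2)]
  have h4 : ∑ Y ∈ U.powerset with Y.Nonempty ∧ Y.card ≤ s, (1 / (2 * k) : ℝ) ^ Y.card
      ≤ ∑ Y ∈ U.powerset.erase ∅, (1 / (2 * k) : ℝ) ^ Y.card := by
    refine Finset.sum_le_sum_of_subset_of_nonneg (fun Y hY => ?_) fun _ _ _ => by positivity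
    obtain ⟨h, h', -⟩ := Finset.mem_filter.1 hY
    exact Finset.mem_erase.2 ⟨h'.ne_empty, h⟩
  have h5 := Finset.add_sum_erase U.powerset (fun Y => (1 / (2 * k) : ℝ) ^ Y.card)
    (Finset.empty_mem_powerset U)
  simp only [Finset.card_empty, pow_zero] at h5
  linarith

open Classical in
/-- Every restriction that is bad for `f` can be recovered, up to `(4 * k) ^ s` possibilities,
from an extension that fixes `s` more variables. -/
theorem exists_decoder {k : ℕ} (hk : 1 ≤ k) {f : (Fin n → Bool) → Bool} (hf : HasCert k f)
    (s : ℕ) :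
    ∃ D : Restriction n → Finset (Restriction n), (∀ ρ', ((D ρ').card : ℝ) ≤ (4 * k) ^ s) ∧
      ∀ ρ, IsBad f s ρ → ∃ ρ', ρ ∈ D ρ' ∧ ρ.Le ρ' ∧ ρ'.stars.card + s = ρ.stars.card := by
  obtain ⟨F, hwidth, himp, hcov⟩ := hf.exists_terms
  induction s using Nat.strong_induction_on with
  | _ s ih =>
  rcases Nat.eq_zero_or_pos s with rfl | hs
  · exact ⟨fun ρ => {ρ}, fun ρ => by simp, fun ρ _ => ⟨ρ, by simp, fun v b h => h, rfl⟩⟩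
  choose D hcard hD using ih
  let ok (ρ T : Restriction n) : Bool := decide (T.Compat ρ)
  -- Decoding for a guess `Y`, `A`: put the answers back on `Y`, decode recursively, then free `Y`.
  let D' (Y : Finset (Fin n)) (A : Finset (Fin n)) (ρ : Restriction n) :
      Finset (Restriction n) :=
    if h : s - Y.card < s then (D (s - Y.card) h (setOn Y A ρ)).image (unset Y) else ∅
  refine ⟨fun ρ' => (F.find? (ok ρ')).elim ∅ fun C =>
      (C.fixed.powerset.filter fun Y => Y.Nonempty ∧ Y.card ≤ s).biUnion fun Y =>
        Y.powerset.biUnion fun A => D' Y A ρ', fun ρ' => ?_, fun ρ hρ => ?_⟩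
  · cases hC : F.find? (ok ρ') with
    | none => simp [hC]
    | some C =>
      simp only [hC, Option.elim_some]
      have hCk : C.fixed.card ≤ k := hwidth C (List.mem_of_find?_eq_some hC)
      refine le_trans ?_ (sum_powerset_nonempty_le hCk hk s)
      refine (Nat.cast_le.2 Finset.card_biUnion_le).trans ?_
      push_cast
      refine Finset.sum_le_sum fun Y hY => ?_
      refine (Nat.cast_le.2 Finset.card_biUnion_le).trans ?_
      push_cast
      have : ∀ A ∈ Y.powerset, ((D' Y A ρ').card : ℝ) ≤ (4 * k) ^ (s - Y.card) := by
        intro A _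
        simp only [D']
        split_ifs with h
        · exact (Nat.cast_le.2 Finset.card_image_le).trans (hcard _ _ _)
        · simp
      refine (Finset.sum_le_card_nsmul _ _ _ this).trans_eq ?_
      simp [Finset.card_powerset]
  · cases hC : F.find? (ok ρ) with
    | none =>
      -- If all terms are falsified, the function is constant, hence not bad.
      refine absurd (hρ 0 (.const _ _ false fun x => ?_)) (by omega)
      by_contra hx
      obtain ⟨T, hT, hTx⟩ := hcov _ (by simpa using hx)
      have := List.find?_eq_none.1 hC T hT
      simp only [ok, decide_eq_true_eq] at this
      refine this fun v b c hb hc => ?_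
      rw [← hTx v b hb]
      simp [Restriction.fill, hc]
    | some C =>
      have hCF := List.mem_of_find?_eq_some hC
      have hCρ : C.Compat ρ := by simpa [ok] using List.find?_some hC
      have hne : (C.fixed ∩ ρ.stars).Nonempty := by
        by_contra hemp
        refine absurd (hρ 0 (.const _ _ true fun x => himp C hCF _ fun v b hb => ?_)) (by omega)
        cases hv : ρ v with
        | none => exact absurd ⟨v, by simp [hb, hv]⟩ hemp
        | some c => simp [Restriction.fill, hv, hCρ v b c hb hv]
      obtain ⟨Y, hYsub, hYne, hYs, hYor, A₀, hbad⟩ :=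
        exists_query_of_isBad hs hρ Finset.inter_subset_right hne
      have hlt : s - Y.card < s := by have := hYne.card_pos; omega
      obtain ⟨ρ₂, hmem, hle, hst⟩ := hD _ hlt _ hbad
      have hYρ : ∀ v ∈ Y, ρ v = none := fun v hv => by
        simpa using (Finset.mem_inter.1 (hYsub hv)).2
      have hYC : ∀ v ∈ Y, C v ≠ none := fun v hv => by
        simpa using (Finset.mem_inter.1 (hYsub hv)).1
      have hρρ₂ : ∀ v, v ∉ Y → ∀ b, ρ v = some b → ρ₂ v = some b := fun v hv b hb =>
        hle v b (by simpa [setOn, hv] using hb)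
      have hρ₂Y : ∀ v ∈ Y, ρ₂ v = some (decide (v ∈ A₀)) := fun v hv =>
        hle v _ (by simp [setOn, hv])
      -- On `Y` the encoding stores the values that satisfy `C` instead of the answers `A₀`, so that
      -- `C` remains recognizable.
      let ρ' : Restriction n := fun v => if v ∈ Y then C v else ρ₂ v
      have hρ' : ρ.Le ρ' := fun v b hb => by
        by_cases hv : v ∈ Y
        · simp [hYρ v hv] at hb
        · simpa [ρ', hv] using hρρ₂ v hv b hb
      have hstars : ρ'.stars = ρ₂.stars := by
        ext v
        by_cases hv : v ∈ Y
        · simp [ρ', hv, hYC v hv, hρ₂Y v hv]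
        · simp [ρ', hv]
      have hsetstars : (setOn Y A₀ ρ).stars.card + Y.card = ρ.stars.card := by
        have : (setOn Y A₀ ρ).stars = ρ.stars \ Y := by
          ext v
          by_cases hv : v ∈ Y <;> simp [setOn, hv]
        rw [this, Finset.card_sdiff_add_card_eq_card]
        exact hYsub.trans Finset.inter_subset_right
      have hcompat : C.Compat ρ' := by
        intro v b c hb hc
        by_cases hv : v ∈ Y
        · simp only [ρ', hv, if_true] at hc
          rw [hb] at hc
          exact Option.some.inj hc
        · simp only [ρ', hv, if_false] at hc
          cases hρv : ρ v with
          | some d =>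
            have := hρρ₂ v hv d hρv
            rw [hc] at this
            rw [Option.some.inj this]
            exact hCρ v b d hb hρv
          | none =>
            rcases hYor with rfl | hYs'
            · exact absurd (Finset.mem_inter.2 ⟨by simp [hb], by simp [hρv]⟩) hv
            -- If `Y` was truncated to `s` variables, the recursion has threshold `0` and fixes
            -- nothing more, so `v` is still free.
            · have hsub : ρ₂.stars ⊆ (setOn Y A₀ ρ).stars := fun u hu => by
                rw [mem_stars] at hu ⊢
                by_contra hne
                obtain ⟨d, hd⟩ := Option.ne_none_iff_exists'.1 hne
                simp [hle u d hd] at hu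
              have heq := Finset.eq_of_subset_of_card_le hsub (by omega)
              have : v ∈ ρ₂.stars := by
                rw [heq]; simp [setOn, hv, hρv]
              simp [hc] at this
      have hfind : F.find? (ok ρ') = some C := by
        refine find?_eq_some_of_imp hC (fun T hT => ?_) (by simpa [ok] using hcompat)
        simp only [ok, decide_eq_true_eq] at hT ⊢
        exact fun v b c hb hc => hT v b c hb (hρ' v c hc)
      refine ⟨ρ', ?_, hρ', by rw [hstars]; omega⟩
      simp only [hfind, Option.elim_some]
      -- The decoder only tries subsets of `Y`, and `setOn` ignores `A₀` outside `Y`.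
      refine Finset.mem_biUnion.2 ⟨Y, ?_, Finset.mem_biUnion.2 ⟨A₀ ∩ Y, by simp, ?_⟩⟩
      · simp only [Finset.mem_filter, Finset.mem_powerset]
        exact ⟨hYsub.trans Finset.inter_subset_left, hYne, hYs⟩
      · simp only [D', hlt, dif_pos]
        have e : setOn Y (A₀ ∩ Y) ρ' = ρ₂ := by
          funext v
          by_cases hv : v ∈ Y
          · simp [setOn, hv, hρ₂Y v hv]
          · simp [setOn, hv, ρ']
        rw [e]
        refine Finset.mem_image.2 ⟨_, hmem, ?_⟩
        funext v
        by_cases hv : v ∈ Y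
        · simp [unset, hv, hYρ v hv]
        · simp [unset, setOn, hv]

end ParityCircuit

/-! ### Random restrictions and the switching lemma -/

namespace ParityCircuit

open Restriction

variable {n : ℕ}

/-- The weight of a restriction that leaves each variable free with probability
`1 / (2 * m + 1)`, up to normalization. -/
def Restriction.weight (m : ℕ) (ρ : Restriction n) : ℝ :=
  ∏ v, if ρ v = none then 1 else (m : ℝ)

theorem Restriction.weight_nonneg (m : ℕ) (ρ : Restriction n) : 0 ≤ ρ.weight m :=
  Finset.prod_nonneg fun v _ => by split_ifs <;> positivity

theorem Restriction.weight_eq (m : ℕ) (ρ : Restriction n) :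
    ρ.weight m = (m : ℝ) ^ ρ.fixed.card := by
  simp [weight, fixed, Finset.prod_ite]

theorem Restriction.weight_of_card_stars {m s : ℕ} {ρ ρ' : Restriction n}
    (h : ρ'.stars.card + s = ρ.stars.card) : ρ'.weight m = ρ.weight m * (m : ℝ) ^ s := by
  have h1 := ρ.card_stars_add_card_fixed
  have h2 := ρ'.card_stars_add_card_fixed
  rw [weight_eq, weight_eq, ← pow_add]
  congr 1
  omega

theorem sum_prod_restriction (g : Fin n → Option Bool → ℝ) :
    ∑ ρ : Restriction n, ∏ v, g v (ρ v) = ∏ v, ∑ o, g v o := by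
  rw [Finset.prod_univ_sum, Fintype.piFinset_univ]

theorem sum_weight (m : ℕ) : ∑ ρ : Restriction n, ρ.weight m = (2 * m + 1 : ℝ) ^ n := by
  unfold weight
  rw [sum_prod_restriction (n := n) fun _ o => if o = none then 1 else (m : ℝ)]
  simp [Fintype.sum_option]
  ring

theorem sum_weight_of_none (m : ℕ) (v : Fin n) :
    (∑ ρ : Restriction n with ρ v = none, ρ.weight m) * (2 * m + 1) = (2 * m + 1 : ℝ) ^ n := by
  -- The condition is moved into the factor at `v`, so that the sum factors over the variables.
  have e : ∀ ρ : Restriction n, (if ρ v = none then ρ.weight m else 0) =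
      ∏ u, (if u = v ∧ ρ u ≠ none then 0 else if ρ u = none then 1 else (m : ℝ)) := by
    intro ρ
    split_ifs with h
    · refine Finset.prod_congr rfl fun u _ => ?_
      by_cases hu : u = v
      · subst hu; simp [h]
      · simp [hu]
    · exact (Finset.prod_eq_zero (Finset.mem_univ v) (by simp [h])).symm
  rw [Finset.sum_filter, Finset.sum_congr rfl fun ρ _ => e ρ,
    sum_prod_restriction (n := n)
      fun u o => if u = v ∧ o ≠ none then 0 else if o = none then 1 else (m : ℝ),
    ← Finset.prod_erase_mul _ _ (Finset.mem_univ v)]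
  have h1 : ∀ u ∈ Finset.univ.erase v, (∑ o : Option Bool,
      if u = v ∧ o ≠ none then 0 else if o = none then 1 else (m : ℝ)) = 2 * m + 1 := by
    intro u hu
    simp [Fintype.sum_option, (Finset.mem_erase.1 hu).1]
    ring
  rw [Finset.prod_congr rfl h1]
  have hn : n = (n - 1) + 1 := by have := v.pos; omega
  conv_rhs => rw [hn, pow_succ]
  simp

theorem sum_weight_mul_card (m : ℕ) (L : Finset (Fin n)) :
    (∑ ρ : Restriction n, ρ.weight m * (L ∩ ρ.stars).card) * (2 * m + 1)
      = L.card * (2 * m + 1 : ℝ) ^ n := by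
  have e : ∀ ρ : Restriction n, ρ.weight m * ((L ∩ ρ.stars).card : ℝ)
      = ∑ v ∈ L, if ρ v = none then ρ.weight m else 0 := by
    intro ρ
    have : L ∩ ρ.stars = L.filter fun v => ρ v = none := by ext v; simp
    rw [this, ← Finset.sum_filter, Finset.sum_const, nsmul_eq_mul, mul_comm]
  rw [Finset.sum_congr rfl fun ρ _ => e ρ, Finset.sum_comm, Finset.sum_mul]
  simp_rw [← Finset.sum_filter, sum_weight_of_none]
  simp

open Classical in
/-- The switching lemma. -/
theorem switching {k : ℕ} (hk : 1 ≤ k) {f : (Fin n → Bool) → Bool} (hf : HasCert k f) (s : ℕ) :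
    (∑ ρ : Restriction n with IsBad f s ρ, ρ.weight (8 * k)) * 2 ^ s
      ≤ (2 * (8 * k : ℕ) + 1 : ℝ) ^ n := by
  obtain ⟨D, hcard, hD⟩ := exists_decoder hk hf s
  choose! g hmem hle hst using hD
  have hk0 : (0 : ℝ) < 4 * k := by
    have : (0 : ℝ) < k := by exact_mod_cast hk
    linarith
  set B : Finset (Restriction n) := Finset.univ.filter (IsBad f s) with hB
  have hBm : ∀ ρ ∈ B, IsBad f s ρ := fun ρ hρ => (Finset.mem_filter.1 hρ).2
  have h1 : (∑ ρ ∈ B, ρ.weight (8 * k)) * ((8 * k : ℕ) : ℝ) ^ s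
      = ∑ ρ ∈ B, (g ρ).weight (8 * k) := by
    rw [Finset.sum_mul]
    exact Finset.sum_congr rfl fun ρ hρ => (weight_of_card_stars (hst ρ (hBm ρ hρ))).symm
  have h2 : ∑ ρ ∈ B, (g ρ).weight (8 * k)
      ≤ ∑ ρ' : Restriction n, (4 * k : ℝ) ^ s * ρ'.weight (8 * k) := by
    -- Group by the encoding: each fibre lies in `D ρ'`. Encoding gains a factor `(8 * k) ^ s` in
    -- weight against `(4 * k) ^ s` preimages, which leaves `2 ^ s`.
    rw [Finset.sum_comp (fun ρ' => Restriction.weight (8 * k) ρ') g]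
    refine (Finset.sum_le_sum fun ρ' _ => ?_).trans
      (Finset.sum_le_sum_of_subset_of_nonneg (Finset.subset_univ _) fun ρ' _ _ =>
        mul_nonneg (by positivity) (weight_nonneg _ _))
    rw [nsmul_eq_mul]
    refine mul_le_mul_of_nonneg_right (le_trans ?_ (hcard ρ')) (weight_nonneg _ _)
    refine Nat.cast_le.2 (Finset.card_le_card fun ρ hρ => ?_)
    obtain ⟨hρB, rfl⟩ := Finset.mem_filter.1 hρ
    exact hmem ρ (hBm ρ hρB)
  rw [← Finset.mul_sum, sum_weight] at h2
  have h3 : ((8 * k : ℕ) : ℝ) ^ s = (4 * k : ℝ) ^ s * 2 ^ s := by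
    rw [← mul_pow]; push_cast; ring
  rw [← h1, h3] at h2
  refine le_of_mul_le_mul_left ?_ (pow_pos hk0 s)
  linarith

theorem isBad_succ {f : (Fin n → Bool) → Bool} {s : ℕ} {ρ : Restriction n}
    (h : ¬ DecTree s (fun x => f (ρ.fill x))) : IsBad f (s + 1) ρ := by
  intro t ht
  by_contra hlt
  exact h (ht.mono (by omega))

-- Negation preserves decision tree depth, so the switching lemma serves conjunctions as well.
-- Having no tree of depth `s` means depth at least `s + 1`, whence the exponent.
open Classical in
theorem sum_weight_not_decTree_le {k : ℕ} (hk : 1 ≤ k) {f : (Fin n → Bool) → Bool}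
    (hf : HasCert k f ∨ HasCert k fun x => !f x) (s : ℕ) :
    (∑ ρ : Restriction n with ¬ DecTree s (fun x => f (ρ.fill x)), ρ.weight (8 * k)) * 2 ^ (s + 1)
      ≤ (2 * (8 * k : ℕ) + 1 : ℝ) ^ n := by
  rcases hf with hf | hf
  · refine le_trans (mul_le_mul_of_nonneg_right ?_ (by positivity)) (switching hk hf (s + 1))
    refine Finset.sum_le_sum_of_subset_of_nonneg (fun ρ hρ => ?_) fun _ _ _ => weight_nonneg _ _
    simp only [Finset.mem_filter, Finset.mem_univ, true_and] at hρ ⊢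
    exact isBad_succ hρ
  · refine le_trans (mul_le_mul_of_nonneg_right ?_ (by positivity)) (switching hk hf (s + 1))
    refine Finset.sum_le_sum_of_subset_of_nonneg (fun ρ hρ => ?_) fun _ _ _ => weight_nonneg _ _
    simp only [Finset.mem_filter, Finset.mem_univ, true_and] at hρ ⊢
    exact isBad_succ fun h => hρ (by simpa using h.not)

open Classical in
/-- Some restriction simplifies all functions of a family and keeps many variables of `L` free. -/
theorem exists_simplifying_restriction {ι : Type*} (I : Finset ι)
    (f : ι → (Fin n → Bool) → Bool) {k s : ℕ} (hk : 1 ≤ k)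
    (hf : ∀ i ∈ I, HasCert k (f i) ∨ HasCert k fun x => !f i x)
    (hI : 17 * k * I.card ≤ 2 ^ s) (L : Finset (Fin n)) (hL : L.Nonempty) :
    ∃ ρ : Restriction n, (∀ i ∈ I, DecTree s (fun x => f i (ρ.fill x))) ∧
      L.card ≤ 68 * k * (L ∩ ρ.stars).card := by
  -- The expected size of `L ∩ ρ.stars` is at least `L.card / (17 * k)`. If the claim fails, good
  -- restrictions contribute at most `L.card / (68 * k)`, and bad ones, of probability at most `1 /
  -- (34 * k)`, at most `L.card / (34 * k)`: only three quarters of it.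
  by_contra! hcon
  set m := 8 * k with hm
  set W : ℝ := (2 * m + 1 : ℝ) ^ n with hW
  have hWpos : 0 < W := by positivity
  have hLpos : (0 : ℝ) < L.card := by exact_mod_cast hL.card_pos
  have hkR : (1 : ℝ) ≤ k := by exact_mod_cast hk
  have hmR : (m : ℝ) = 8 * k := by rw [hm]; push_cast; ring
  set B : Finset (Restriction n) :=
    Finset.univ.filter fun ρ => ∃ i ∈ I, ¬ DecTree s (fun x => f i (ρ.fill x)) with hB
  have hbad : (∑ ρ ∈ B, ρ.weight m) * 2 ^ (s + 1) ≤ I.card * W := by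
    have h1 : ∑ ρ ∈ B, ρ.weight m ≤ ∑ i ∈ I,
        ∑ ρ : Restriction n with ¬ DecTree s (fun x => f i (ρ.fill x)), ρ.weight m := by
      simp_rw [Finset.sum_filter]
      rw [Finset.sum_comm, hB, Finset.sum_filter]
      refine Finset.sum_le_sum fun ρ _ => ?_
      have h0 : ∀ i ∈ I, 0 ≤ if ¬ DecTree s (fun x => f i (ρ.fill x)) then ρ.weight m else 0 :=
        fun i _ => by split_ifs <;> simp [weight_nonneg]
      split_ifs with h
      · obtain ⟨i, hi, hd⟩ := h
        exact le_trans (by simp [hd]) (Finset.single_le_sum h0 hi)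
      · exact Finset.sum_nonneg h0
    refine (mul_le_mul_of_nonneg_right h1 (by positivity)).trans ?_
    rw [Finset.sum_mul]
    refine (Finset.sum_le_card_nsmul _ _ W fun i hi =>
      sum_weight_not_decTree_le hk (hf i hi) s).trans_eq (by simp)
  have hbad' : (∑ ρ ∈ B, ρ.weight m) * (34 * k) ≤ W := by
    have hI' : (17 * k * I.card : ℝ) ≤ 2 ^ s := by exact_mod_cast hI
    have h2 : (∑ ρ ∈ B, ρ.weight m) * 2 ^ (s + 1) * (17 * k) ≤ 2 ^ s * W := by
      calc _ ≤ I.card * W * (17 * k) := by gcongr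
        _ = (17 * k * I.card) * W := by ring
        _ ≤ _ := by gcongr
    have h3 : (0 : ℝ) < 2 ^ s := by positivity
    refine le_of_mul_le_mul_left ?_ h3
    rw [pow_succ] at h2
    linarith
  have hpt : ∀ ρ : Restriction n, ρ.weight m * (L ∩ ρ.stars).card
      ≤ ρ.weight m * (L.card / (68 * k)) + if ρ ∈ B then ρ.weight m * L.card else 0 := by
    intro ρ
    have hw := weight_nonneg m ρ
    split_ifs with h
    · have : ((L ∩ ρ.stars).card : ℝ) ≤ L.card :=
        Nat.cast_le.2 (Finset.card_le_card Finset.inter_subset_left)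
      have h1 := mul_le_mul_of_nonneg_left this hw
      have h2 : 0 ≤ ρ.weight m * (L.card / (68 * k)) := by positivity
      linarith
    · have hgood : ∀ i ∈ I, DecTree s (fun x => f i (ρ.fill x)) := by
        simpa [hB] using h
      have h1 : (68 * k * (L ∩ ρ.stars).card : ℝ) < L.card := by exact_mod_cast hcon ρ hgood
      rw [add_zero]
      refine mul_le_mul_of_nonneg_left ?_ hw
      rw [le_div_iff₀ (by positivity)]
      linarith
  have hsum := Finset.sum_le_sum fun ρ (_ : ρ ∈ (Finset.univ : Finset (Restriction n))) => hpt ρ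
  rw [Finset.sum_add_distrib, ← Finset.sum_mul, sum_weight, ← Finset.sum_filter,
    Finset.filter_mem_eq_inter, Finset.univ_inter, ← Finset.sum_mul] at hsum
  have hmain := sum_weight_mul_card m L
  rw [← hW] at hmain hsum
  set X := ∑ ρ : Restriction n, ρ.weight m * ((L ∩ ρ.stars).card : ℝ)
  set b := ∑ ρ ∈ B, ρ.weight m
  have hX : L.card * W ≤ X * (17 * k) := by
    rw [← hmain]
    have hX0 : 0 ≤ X := Finset.sum_nonneg fun ρ _ =>
      mul_nonneg (weight_nonneg _ _) (Nat.cast_nonneg _)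
    exact mul_le_mul_of_nonneg_left (by rw [hmR]; linarith) hX0
  have h4 : X * (17 * k) ≤ L.card * W / 4 + L.card * W / 2 := by
    have h5 : b * L.card * (17 * k) ≤ L.card * W / 2 := by nlinarith
    have h6 : W * (L.card / (68 * k)) * (17 * k) = L.card * W / 4 := by
      field_simp
      norm_num
    have := mul_le_mul_of_nonneg_right hsum (by positivity : (0 : ℝ) ≤ 17 * k)
    rw [add_mul, h6] at this
    linarith
  have : 0 < L.card * W := by positivity
  linarith

end ParityCircuit

/-! ### Restricting a circuit layer by layer -/

namespace ParityCircuit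

open Restriction

variable {n : ℕ}

namespace Circuit

/-- The value of an input variable or of an earlier gate. -/
def nodeVal (C : Circuit n) {i : ℕ} (hi : i ≤ C.numGates) (x : Fin n → Bool) (c : Fin n ⊕ Fin i) :
    Bool :=
  Sum.elim x (fun j : Fin i => C.gateVal x j.val (j.isLt.trans_le hi)) c

/-- The depth of an input variable or of an earlier gate. -/
def nodeDepth (C : Circuit n) {i : ℕ} (hi : i ≤ C.numGates) (c : Fin n ⊕ Fin i) : ℕ :=
  Sum.elim (fun _ => 0) (fun j : Fin i => C.gateDepth j.val (j.isLt.trans_le hi)) c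

section unfold

variable (C : Circuit n) {i : ℕ} (hi : i < C.numGates)

theorem gateVal_conj {S : Finset (Fin n ⊕ Fin i)} (h : C.gate ⟨i, hi⟩ = .conj S)
    (x : Fin n → Bool) :
    C.gateVal x i hi = decide (∀ c ∈ S, C.nodeVal hi.le x c = true) := by
  rw [gateVal, h]; rfl

theorem gateVal_disj {S : Finset (Fin n ⊕ Fin i)} (h : C.gate ⟨i, hi⟩ = .disj S)
    (x : Fin n → Bool) :
    C.gateVal x i hi = decide (∃ c ∈ S, C.nodeVal hi.le x c = true) := by
  rw [gateVal, h]; rfl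

theorem gateVal_neg {c : Fin n ⊕ Fin i} (h : C.gate ⟨i, hi⟩ = .neg c) (x : Fin n → Bool) :
    C.gateVal x i hi = !C.nodeVal hi.le x c := by
  rw [gateVal, h]; rfl

theorem gateDepth_conj {S : Finset (Fin n ⊕ Fin i)} (h : C.gate ⟨i, hi⟩ = .conj S) :
    C.gateDepth i hi = S.sup (C.nodeDepth hi.le) + 1 := by
  rw [gateDepth, h]; rfl

theorem gateDepth_disj {S : Finset (Fin n ⊕ Fin i)} (h : C.gate ⟨i, hi⟩ = .disj S) :
    C.gateDepth i hi = S.sup (C.nodeDepth hi.le) + 1 := by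
  rw [gateDepth, h]; rfl

theorem gateDepth_neg {c : Fin n ⊕ Fin i} (h : C.gate ⟨i, hi⟩ = .neg c) :
    C.gateDepth i hi = C.nodeDepth hi.le c := by
  rw [gateDepth, h]; rfl

end unfold

/-- Under `ρ`, all gates of depth at most `d` have decision trees of depth at most `t`. -/
def SimpleUpTo (C : Circuit n) (d t : ℕ) (ρ : Restriction n) : Prop :=
  ∀ i hi, C.gateDepth i hi ≤ d → DecTree t (fun x => C.gateVal (ρ.fill x) i hi)

theorem SimpleUpTo.node {C : Circuit n} {d t : ℕ} {ρ : Restriction n} (h : C.SimpleUpTo d t ρ)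
    (ht : 1 ≤ t) {i : ℕ} (hi : i ≤ C.numGates) (c : Fin n ⊕ Fin i) (hc : C.nodeDepth hi c ≤ d) :
    DecTree t (fun x => C.nodeVal hi (ρ.fill x) c) := by
  cases c with
  | inl v => exact (DecTree.literal v ht).fill ρ
  | inr j => exact h j.val _ hc

/-- Negations are free: only conjunctions and disjunctions have to be considered. -/
theorem simpleUpTo_of_weight {C : Circuit n} {d t : ℕ} {ρ : Restriction n} (ht : 1 ≤ t)
    (h : ∀ i hi, (C.gate ⟨i, hi⟩).weight = 1 → C.gateDepth i hi ≤ d →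
      DecTree t (fun x => C.gateVal (ρ.fill x) i hi)) : C.SimpleUpTo d t ρ := by
  intro i
  induction i using Nat.strong_induction_on with
  | _ i ih =>
  intro hi hd
  cases hg : C.gate ⟨i, hi⟩ with
  | conj S => exact h i hi (by rw [hg]; rfl) hd
  | disj S => exact h i hi (by rw [hg]; rfl) hd
  | neg c =>
    simp only [C.gateVal_neg hi hg]
    rw [C.gateDepth_neg hi hg] at hd
    refine DecTree.not (f := fun x => C.nodeVal hi.le (ρ.fill x) c) ?_
    cases c with
    | inl v => exact (DecTree.literal v ht).fill ρ
    | inr j => exact ih j.val j.isLt _ hd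

/-- A gate of depth zero is a chain of negations on an input, hence a literal. -/
theorem simpleUpTo_zero (C : Circuit n) (ρ : Restriction n) : C.SimpleUpTo 0 1 ρ := by
  refine simpleUpTo_of_weight le_rfl fun i hi hw hd => ?_
  cases hg : C.gate ⟨i, hi⟩ with
  | conj S => simp [C.gateDepth_conj hi hg] at hd
  | disj S => simp [C.gateDepth_disj hi hg] at hd
  | neg c => rw [hg] at hw; cases hw

/-- One true child certifies a disjunction and one false child refutes a conjunction; the child's
tree supplies the certificate. Negations swap the two alternatives. -/
theorem SimpleUpTo.hasCert {C : Circuit n} {d t : ℕ} {ρ : Restriction n} (h : C.SimpleUpTo d t ρ)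
    (ht : 1 ≤ t) : ∀ i hi, C.gateDepth i hi ≤ d + 1 →
      HasCert t (fun x => C.gateVal (ρ.fill x) i hi) ∨
      HasCert t (fun x => !C.gateVal (ρ.fill x) i hi) := by
  intro i
  induction i using Nat.strong_induction_on with
  | _ i ih =>
  intro hi hd
  cases hg : C.gate ⟨i, hi⟩ with
  | conj S =>
    right
    simp only [C.gateVal_conj hi hg]
    rw [C.gateDepth_conj hi hg] at hd
    intro x hx
    simp only [Bool.not_eq_true', decide_eq_false_iff_not, not_forall] at hx ⊢
    obtain ⟨c, hc, hxc⟩ := hx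
    have hcd : C.nodeDepth hi.le c ≤ d := (Finset.le_sup hc).trans (by omega)
    obtain ⟨Y, hY, hcert⟩ := (h.node ht hi.le c hcd).not.hasCert x (by simpa using hxc)
    exact ⟨Y, hY, fun y hy => ⟨c, hc, by simpa using hcert y hy⟩⟩
  | disj S =>
    left
    simp only [C.gateVal_disj hi hg]
    rw [C.gateDepth_disj hi hg] at hd
    intro x hx
    simp only [decide_eq_true_eq] at hx ⊢
    obtain ⟨c, hc, hxc⟩ := hx
    have hcd : C.nodeDepth hi.le c ≤ d := (Finset.le_sup hc).trans (by omega)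
    obtain ⟨Y, hY, hcert⟩ := (h.node ht hi.le c hcd).hasCert x hxc
    exact ⟨Y, hY, fun y hy => ⟨c, hc, hcert y hy⟩⟩
  | neg c =>
    simp only [C.gateVal_neg hi hg, Bool.not_not]
    rw [C.gateDepth_neg hi hg] at hd
    cases c with
    | inl v => exact Or.inr ((DecTree.literal v ht).fill ρ).hasCert
    | inr j => exact (ih j.val j.isLt _ hd).symm

theorem size_eq_card (C : Circuit n) :
    C.size = (Finset.univ.filter fun i => (C.gate i).weight = 1).card := by
  rw [Finset.card_filter]
  refine Finset.sum_congr rfl fun i _ => ?_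
  cases C.gate i <;> rfl

open Classical in
/-- One round of the restriction argument. -/
theorem SimpleUpTo.exists_succ {C : Circuit n} {d k s : ℕ} {ρ : Restriction n}
    (h : C.SimpleUpTo d k ρ) (hk : 1 ≤ k) (hs : 1 ≤ s) (hS : 17 * k * C.size ≤ 2 ^ s)
    (hρ : 0 < ρ.stars.card) :
    ∃ ρ' : Restriction n, C.SimpleUpTo (d + 1) s ρ' ∧
      ρ.stars.card ≤ 68 * k * ρ'.stars.card := by
  let I : Finset (Fin C.numGates) := Finset.univ.filter fun i =>
    (C.gate i).weight = 1 ∧ C.gateDepth i.val i.isLt ≤ d + 1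
  have hI : I.card ≤ C.size := by
    rw [size_eq_card]
    exact Finset.card_le_card fun i hi => by
      simp only [I, Finset.mem_filter] at hi ⊢
      exact ⟨hi.1, hi.2.1⟩
  obtain ⟨σ, hσ, hL⟩ := exists_simplifying_restriction I
    (fun i x => C.gateVal (ρ.fill x) i.val i.isLt) (s := s) hk
    (fun i hi => h.hasCert hk i.val i.isLt (Finset.mem_filter.1 hi).2.2)
    ((Nat.mul_le_mul_left _ hI).trans hS) ρ.stars (Finset.card_pos.1 hρ)
  refine ⟨ρ.comp σ, simpleUpTo_of_weight hs fun i hi hw hd => ?_, by rwa [stars_comp]⟩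
  simp only [fill_comp]
  exact hσ ⟨i, hi⟩ (by simp [I, hw, hd])

end Circuit

/-! ### Parity against depth four -/

theorem parity_update_not (x : Fin n → Bool) (v : Fin n) :
    parity (Function.update x v (!x v)) = !parity x := by
  unfold parity
  rw [← decide_not, decide_eq_decide]
  cases hx : x v with
  | false =>
    have e : (Finset.univ.filter fun i => Function.update x v (!false) i = true)
        = insert v (Finset.univ.filter fun i => x i = true) := by
      ext i
      by_cases hi : i = v
      · subst hi; simp
      · simp [hi]
    rw [e, Finset.card_insert_of_notMem (by simp [hx]), Nat.odd_add_one]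
  | true =>
    have e : (Finset.univ.filter fun i => x i = true)
        = insert v (Finset.univ.filter fun i => Function.update x v (!true) i = true) := by
      ext i
      by_cases hi : i = v
      · subst hi; simp [hx]
      · simp [hi]
    rw [e, Finset.card_insert_of_notMem (by simp), Nat.odd_add_one, not_not]

/-- A function that changes with every free variable has no small certificates. -/
theorem HasCert.card_le {s : ℕ} {f : (Fin n → Bool) → Bool} (h : HasCert s f)
    (L : Finset (Fin n)) (hL : L.Nonempty)
    (hf : ∀ x, ∀ v ∈ L, f (Function.update x v (!x v)) = !f x) : L.card ≤ s := by
  obtain ⟨x, hx⟩ : ∃ x, f x = true := by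
    obtain ⟨v, hv⟩ := hL
    cases hx : f fun _ => false with
    | true => exact ⟨_, hx⟩
    | false => exact ⟨_, by rw [hf _ v hv, hx]; rfl⟩
  obtain ⟨Y, hY, hc⟩ := h x hx
  refine le_trans (Finset.card_le_card fun v hv => ?_) hY
  by_contra hvY
  have := hc (Function.update x v (!x v)) fun u hu =>
    Function.update_of_ne (by rintro rfl; exact hvY hu) _ _
  rw [hf x v hv, hx] at this
  cases this

theorem Circuit.le_of_eval_eq_parity {C : Circuit n} (hd : C.depth ≤ 4)
    (hC : ∀ x, C.eval x = parity x) {s : ℕ} (hs : 1 ≤ s) (hS : 17 * s * C.size ≤ 2 ^ s)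
    (hn : 0 < n) : n ≤ (68 * s) ^ 3 := by
  have h0 := C.simpleUpTo_zero fun _ => none
  have hc0 : (Restriction.stars fun _ : Fin n => none).card = n := by simp [stars]
  -- Here `k = 1`, so no factor `s` is lost; this makes the final exponent three rather than four.
  obtain ⟨ρ₁, h1, hc1⟩ := h0.exists_succ le_rfl hs
    ((Nat.mul_le_mul_right _ (by omega)).trans hS) (by omega)
  rw [hc0] at hc1
  obtain ⟨ρ₂, h2, hc2⟩ := h1.exists_succ hs hs hS (Nat.pos_of_ne_zero fun e => by simp [e] at hc1; omega)
  have hp1 : 0 < ρ₁.stars.card := Nat.pos_of_ne_zero fun e => by simp [e] at hc1; omega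
  have hp2 : 0 < ρ₂.stars.card := Nat.pos_of_ne_zero fun e => by simp [e] at hc2; simp [hc2] at hp1
  obtain ⟨ρ₃, h3, hc3⟩ := h2.exists_succ hs hs hS hp2
  have hp3 : 0 < ρ₃.stars.card := Nat.pos_of_ne_zero fun e => by simp [e] at hc3; simp [hc3] at hp2
  have hpar : ∀ x, ∀ v ∈ ρ₃.stars,
      C.eval (ρ₃.fill (Function.update x v (!x v))) = !C.eval (ρ₃.fill x) := by
    intro x v hv
    have e : ρ₃.fill x v = x v := by simp [Restriction.fill, mem_stars.1 hv]
    rw [fill_update_of_none (mem_stars.1 hv), hC, hC, ← e, parity_update_not]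
  have hcert : HasCert s (fun x => C.eval (ρ₃.fill x)) ∨
      HasCert s (fun x => !C.eval (ρ₃.fill x)) := by
    unfold Circuit.eval
    unfold Circuit.depth at hd
    cases ho : C.output with
    | inl v => exact Or.inl ((DecTree.literal v hs).fill ρ₃).hasCert
    | inr j =>
      rw [ho] at hd
      -- Three rounds settle depth three; the fourth layer needs only certificates.
      exact h3.hasCert hs j.val j.isLt hd
  have hfin : ρ₃.stars.card ≤ s := by
    rcases hcert with h | h
    · exact h.card_le _ (Finset.card_pos.1 hp3) hpar
    · exact h.card_le _ (Finset.card_pos.1 hp3) fun x v hv => by rw [hpar x v hv]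
  calc n ≤ 68 * 1 * ρ₁.stars.card := hc1
    _ ≤ 68 * 1 * (68 * s * ρ₂.stars.card) := by gcongr
    _ ≤ 68 * 1 * (68 * s * (68 * s * ρ₃.stars.card)) := by gcongr
    _ ≤ 68 * 1 * (68 * s * (68 * s * s)) := by gcongr
    _ = (68 * s) ^ 3 := by ring

/-! ### Choice of parameters -/

theorem tendsto_log_div_log : Tendsto (fun n : ℕ => Real.log 200 / Real.log n) atTop (𝓝 0) :=
  (Real.tendsto_log_atTop.comp tendsto_natCast_atTop_atTop).const_div_atTop _

/-- A constant factor `1 / 200` is a vanishing change of the exponent, since `n ^ (log 200 / log n)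
= 200`. -/
theorem rpow_sub_log_div_log {n : ℕ} (hn : 1 < n) :
    (n : ℝ) ^ ((1 : ℝ) / 3 - Real.log 200 / Real.log n) = (n : ℝ) ^ ((1 : ℝ) / 3) / 200 := by
  have hn' : (1 : ℝ) < n := by exact_mod_cast hn
  have hl : Real.log n ≠ 0 := (Real.log_pos hn').ne'
  rw [Real.rpow_sub (by linarith), Real.rpow_def_of_pos (by linarith) (Real.log 200 / Real.log n),
    mul_div_cancel₀ _ hl, Real.exp_log (by norm_num)]

theorem sq_le_two_pow {s : ℕ} (hs : 100 ≤ s) : (17 * s) ^ 2 ≤ 2 ^ s := by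
  induction s, hs using Nat.le_induction with
  | base => norm_num
  | succ s hs ih =>
    rw [pow_succ 2 s]
    nlinarith

/-- Take `s = ⌊n ^ (1 / 3) / 69⌋₊`: `69 > 68` makes the cube strictly smaller than `n`, and `200`
exceeds `2 * 69` with enough room that half of the exponent `s` is left to absorb `17 * s`. -/
theorem eventually_bound : ∀ᶠ n : ℕ in atTop, ∃ s : ℕ, 1 ≤ s ∧ (68 * s) ^ 3 < n ∧
    (17 * s : ℝ) * 2 ^ ((n : ℝ) ^ ((1 : ℝ) / 3) / 200) ≤ 2 ^ s := by
  have hr : Tendsto (fun n : ℕ => (n : ℝ) ^ ((1 : ℝ) / 3)) atTop atTop :=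
    (tendsto_rpow_atTop (by norm_num)).comp tendsto_natCast_atTop_atTop
  have hs : Tendsto (fun n : ℕ => ⌊(n : ℝ) ^ ((1 : ℝ) / 3) / 69⌋₊) atTop atTop :=
    tendsto_nat_floor_atTop.comp (hr.atTop_div_const (by norm_num))
  filter_upwards [hs.eventually_ge_atTop 100, eventually_gt_atTop 0] with n hn hn0
  set r := (n : ℝ) ^ ((1 : ℝ) / 3) with hrdef
  set s := ⌊r / 69⌋₊ with hsdef
  have hr0 : 0 < r := Real.rpow_pos_of_pos (by exact_mod_cast hn0) _
  have hr3 : r ^ 3 = n := by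
    rw [hrdef, ← Real.rpow_natCast, ← Real.rpow_mul (Nat.cast_nonneg n)]
    norm_num
  have h1 : (s : ℝ) ≤ r / 69 := Nat.floor_le (by positivity)
  have h2 : r / 69 < s + 1 := Nat.lt_floor_add_one _
  have hsR : (100 : ℝ) ≤ s := by exact_mod_cast hn
  refine ⟨s, by omega, ?_, ?_⟩
  · have : ((68 * s : ℕ) : ℝ) ^ 3 < r ^ 3 := by
      refine pow_lt_pow_left₀ ?_ (by positivity) (by norm_num)
      push_cast
      linarith
    rw [hr3] at this
    exact_mod_cast this
  · have hexp : r / 200 ≤ s - s / 2 := by linarith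
    have hpoly : (17 * s : ℝ) ≤ 2 ^ ((s : ℝ) / 2) := by
      refine (pow_le_pow_iff_left₀ (by positivity) (by positivity) two_ne_zero).1 ?_
      rw [← Real.rpow_natCast ((2 : ℝ) ^ ((s : ℝ) / 2)), ← Real.rpow_mul (by norm_num)]
      have e : (s : ℝ) / 2 * (2 : ℕ) = s := by push_cast; ring
      rw [e, Real.rpow_natCast]
      exact_mod_cast sq_le_two_pow hn
    calc (17 * s : ℝ) * 2 ^ (r / 200) ≤ 2 ^ ((s : ℝ) / 2) * 2 ^ ((s : ℝ) - s / 2) := by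
          gcongr
          norm_num
      _ = 2 ^ s := by
          rw [← Real.rpow_add (by norm_num), ← Real.rpow_natCast]
          congr 1
          ring

end ParityCircuit

theorem theorem1 :
    ∃ δ : ℕ → ℝ, Tendsto δ atTop (𝓝 0) ∧
      ∀ᶠ n : ℕ in atTop, ∀ C : ParityCircuit.Circuit n,
        C.depth ≤ 4 → (∀ x : Fin n → Bool, C.eval x = ParityCircuit.parity x) →
          (2 : ℝ) ^ ((n : ℝ) ^ ((1 : ℝ) / 3 - δ n)) ≤ (C.size : ℝ) := by
  refine ⟨_, ParityCircuit.tendsto_log_div_log, ?_⟩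
  filter_upwards [ParityCircuit.eventually_bound, eventually_gt_atTop 1] with n hn hn1 C hd hC
  obtain ⟨s, hs, hsn, hbound⟩ := hn
  rw [ParityCircuit.rpow_sub_log_div_log hn1]
  by_contra! hlt
  refine absurd (C.le_of_eval_eq_parity hd hC hs ?_ (by omega)) (by omega)
  have : (17 * s * C.size : ℝ) ≤ 2 ^ s :=
    (mul_le_mul_of_nonneg_left hlt.le (by positivity)).trans hbound
  exact_mod_cast this
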